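/- Let $N\ge 1$ be an integer, $0<s<1$ and $p\ge q>1$. For $u:\mathbb R^N\to\mathbb R$ write $$(-\Delta)^s u(x)=c_{N,s}\lim_{\epsilon\to0^+}\int_{\mathbb R^N\setminus B_\epsilon(x)}\frac{u(x)-u(y)}{|x-y|^{N+2s}}\,dy,\qquad c_{N,s}=\frac{s\,4^s\,\Gamma(\frac N2+s)}{\pi^{N/2}\,\Gamma(1-s)},$$ and let $\mathcal L_s(\mathbb R^N)$ be the space of functions $u$ with $\int_{\mathbb R^N}\frac{|u(y)|}{(1+|y|)^{N+2s}}\,dy<\infty$. For $\alpha>0$, let $C^{\alpha}(\mathbb R^N)$ be the class of functions that are $\lfloor\alpha\rfloor$ times continuously differentiable and whose derivatives of order $\lfloor\alpha\rfloor$ are locally Hölder continuous with exponent $\alpha-\lfloor\alpha\rfloor$ (no further condition if $\alpha$ is an integer). Let $u,v:\mathbb R^N\to(0,\infty)$ both belong to $C^{2\sigma}(\mathbb R^N)\cap\mathcal L_s(\mathbb R^N)$ for some $\sigma>s$, and suppose that $(u,v)$ solves the fractional Lane–Emden system $$(-\Delta)^s u=v^p,\qquad (-\Delta)^s v=u^q$$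 at every point of $\mathbb R^N$. Then $$\frac{v(x)^{p+1}}{p+1}\le\frac{u(x)^{q+1}}{q+1}\qquad\text{for every }x\in\mathbb R^N.$$ -/

import Mathlib

open Filter Topology MeasureTheory

namespace FracLaneEmden

noncomputable section

/-- The normalization constant `c_{N,s} = s 4^s Γ(N/2 + s) / (π^{N/2} Γ(1 - s))` of the fractional
Laplacian, for which `(-Δ)^s` has the Fourier symbol `|ξ|^{2s}`. -/
def normConst (N : ℕ) (s : ℝ) : ℝ :=
  s * (4 : ℝ) ^ s * Real.Gamma ((N : ℝ) / 2 + s) /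
    (Real.pi ^ ((N : ℝ) / 2) * Real.Gamma (1 - s))

/-- `(-Δ)^s u (x)` exists as a principal value and is equal to `L`. -/
def HasFracLaplacianAt {N : ℕ} (s : ℝ) (u : EuclideanSpace ℝ (Fin N) → ℝ)
    (L : ℝ) (x : EuclideanSpace ℝ (Fin N)) : Prop :=
  Tendsto
    (fun ε : ℝ => normConst N s *
      ∫ y in (Metric.ball x ε)ᶜ, (u x - u y) / ‖x - y‖ ^ ((N : ℝ) + 2 * s))
    (𝓝[>] 0) (𝓝 L)

/-- The (local) Hölder class `C^α(ℝ^N)`, `α ≥ 0`: with `k = ⌊α⌋`, the function is `k` times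
continuously differentiable and its `k`-th derivative is locally Hölder continuous with exponent
`α - k`. If `α = k` is an integer, then the second condition holds for every `C^k` function. -/
def MemLocHolder {N : ℕ} (α : ℝ) (u : EuclideanSpace ℝ (Fin N) → ℝ) : Prop :=
  ContDiff ℝ (⌊α⌋₊ : ℕ) u ∧
    ∀ x, ∃ C : ℝ, ∃ U ∈ 𝓝 x, ∀ y ∈ U, ∀ z ∈ U,
      ‖iteratedFDeriv ℝ ⌊α⌋₊ u y - iteratedFDeriv ℝ ⌊α⌋₊ u z‖ ≤ C * ‖y - z‖ ^ (α - (⌊α⌋₊ : ℝ))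

/-- The weighted space `𝓛_s(ℝ^N)`: `∫ |u(y)| / (1 + |y|)^{N + 2s} dy < ∞`. -/
def MemWeightedL1 {N : ℕ} (s : ℝ) (u : EuclideanSpace ℝ (Fin N) → ℝ) : Prop :=
  Integrable (fun y => u y / (1 + ‖y‖) ^ ((N : ℝ) + 2 * s))

/-- The class `C^{2σ}(ℝ^N) ∩ 𝓛_s(ℝ^N)` for some `σ > s`. -/
def MemSolutionClass {N : ℕ} (s : ℝ) (u : EuclideanSpace ℝ (Fin N) → ℝ) : Prop :=
  (∃ σ : ℝ, s < σ ∧ MemLocHolder (2 * σ) u) ∧ MemWeightedL1 s u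

/-- `(u, v)` is a positive solution of the fractional Lane-Emden system
`(-Δ)^s u = v^p`, `(-Δ)^s v = u^q` in `ℝ^N`. -/
structure IsPositiveSolution {N : ℕ} (s p q : ℝ) (u v : EuclideanSpace ℝ (Fin N) → ℝ) :
    Prop where
  mem_left : MemSolutionClass s u
  mem_right : MemSolutionClass s v
  pos_left : ∀ x, 0 < u x
  pos_right : ∀ x, 0 < v x
  eq_left : ∀ x, HasFracLaplacianAt s u (v x ^ p) x
  eq_right : ∀ x, HasFracLaplacianAt s v (u x ^ q) x

end

end FracLaneEmden

/-! With `τ = (q+1)/(p+1) ≤ 1` and `b ^ (p+1) = τ`, the claim is `W = b v - u^τ ≤ 0`. By concavity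
of `r ↦ r^τ`, the increment `W x - W y` is at most `G y = b (v x - v y) - τ u(x)^(τ-1) (u x - u y)`.
The equations evaluate the principal value of `G` as a multiple of `b u^q - τ u^(τ-1) v^p`, and
where `W > 0` this is at most `-b W^κ` with `κ = p + 1 - 1/τ > 1` (`reaction_le_neg_rpow`).

A positive supremum of `W` need not be attained, so `W` is multiplied by `(1 - |y-z|²/R²)^n` and
maximized over a ball around a point `z` with `W z > 0`. At the maximum the principal value is
bounded below by terms that are small for large `R`, up to negative powers of the bump `t` at the
contact point (`exists_contact_estimate`). Superlinearity of `W^κ` absorbs those powers once `n` is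
large (`rpow_le_of_contact`). As `R → ∞` the weighted tail of `v` vanishes, forcing `W z ≤ 0`. -/

namespace FracLaneEmden

/-! ### Principal values against the singular kernel. -/

section Kernel

variable {N : ℕ}

/-- In polar coordinates the integrand becomes `t ^ (1 - 2s)`, and `1 - 2s > -1`. -/
theorem integrableOn_sq_div_rpow_norm (hN : 1 ≤ N) {s : ℝ} (hs1 : s < 1) (δ : ℝ) :
    IntegrableOn (fun z : EuclideanSpace ℝ (Fin N) => ‖z‖ ^ 2 / ‖z‖ ^ ((N : ℝ) + 2 * s))
      (Metric.ball 0 δ) := by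
  have : Nonempty (Fin N) := ⟨⟨0, hN⟩⟩
  rw [integrableOn_fun_norm_addHaar volume
    (f := fun t : ℝ => t ^ 2 / t ^ ((N : ℝ) + 2 * s))]
  rcases le_or_gt δ 0 with hδ | hδ
  · simp [Set.Ioo_eq_empty_of_le hδ]
  have h := (intervalIntegral.integrableOn_Ioo_rpow_iff (s := 1 - 2 * s) hδ).2 (by linarith)
  refine h.congr_fun (fun t ht => ?_) measurableSet_Ioo
  have ht0 : 0 < t := ht.1
  simp only [finrank_euclideanSpace, Fintype.card_fin, smul_eq_mul]
  rw [← Real.rpow_natCast, ← Real.rpow_natCast, ← Real.rpow_sub ht0, ← Real.rpow_add ht0]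
  congr 1
  push_cast [Nat.cast_sub hN]
  ring

theorem integral_ball_sq_div_rpow_norm (s : ℝ) {δ : ℝ} (hδ : 0 < δ) :
    ∫ z in Metric.ball (0 : EuclideanSpace ℝ (Fin N)) δ, ‖z‖ ^ 2 / ‖z‖ ^ ((N : ℝ) + 2 * s) =
      δ ^ (2 - 2 * s) * ∫ z in Metric.ball (0 : EuclideanSpace ℝ (Fin N)) 1,
        ‖z‖ ^ 2 / ‖z‖ ^ ((N : ℝ) + 2 * s) := by
  have h := Measure.setIntegral_comp_smul_of_pos volume
    (fun z : EuclideanSpace ℝ (Fin N) => ‖z‖ ^ 2 / ‖z‖ ^ ((N : ℝ) + 2 * s))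
    (Metric.ball 0 1) hδ
  rw [smul_unitBall hδ.ne', Real.norm_of_nonneg hδ.le, finrank_euclideanSpace,
    Fintype.card_fin, smul_eq_mul] at h
  have hp : 0 < δ ^ N := by positivity
  rw [eq_inv_mul_iff_mul_eq₀ hp.ne'] at h
  rw [← h]
  have : ∀ z : EuclideanSpace ℝ (Fin N), ‖δ • z‖ ^ 2 / ‖δ • z‖ ^ ((N : ℝ) + 2 * s) =
      (δ ^ 2 / δ ^ ((N : ℝ) + 2 * s)) * (‖z‖ ^ 2 / ‖z‖ ^ ((N : ℝ) + 2 * s)) := by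
    intro z
    rw [norm_smul, Real.norm_of_nonneg hδ.le, Real.mul_rpow hδ.le (norm_nonneg _), mul_pow,
      mul_div_mul_comm]
  simp_rw [this]
  rw [integral_const_mul, ← mul_assoc]
  congr 1
  rw [← Real.rpow_natCast, ← Real.rpow_natCast, ← Real.rpow_sub hδ, ← Real.rpow_add hδ]
  congr 1
  push_cast
  ring

theorem integrableOn_ball_sq_div_rpow_norm_sub (hN : 1 ≤ N) {s : ℝ} (hs1 : s < 1)
    (x : EuclideanSpace ℝ (Fin N)) (δ : ℝ) :
    IntegrableOn (fun y => ‖y - x‖ ^ 2 / ‖x - y‖ ^ ((N : ℝ) + 2 * s)) (Metric.ball x δ) := by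
  have h := (integrable_indicator_iff Metric.isOpen_ball.measurableSet).2
    (integrableOn_sq_div_rpow_norm hN hs1 δ)
  have h2 := h.comp_sub_right x
  rw [← integrable_indicator_iff Metric.isOpen_ball.measurableSet]
  refine h2.congr (.of_forall fun y => ?_)
  simp only [Set.indicator, Metric.mem_ball, dist_eq_norm, sub_zero, norm_sub_rev x y]

theorem integral_ball_sq_div_rpow_norm_sub (s : ℝ) (x : EuclideanSpace ℝ (Fin N)) {δ : ℝ}
    (hδ : 0 < δ) :
    ∫ y in Metric.ball x δ, ‖y - x‖ ^ 2 / ‖x - y‖ ^ ((N : ℝ) + 2 * s) =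
      δ ^ (2 - 2 * s) * ∫ z in Metric.ball (0 : EuclideanSpace ℝ (Fin N)) 1,
        ‖z‖ ^ 2 / ‖z‖ ^ ((N : ℝ) + 2 * s) := by
  rw [← integral_ball_sq_div_rpow_norm s hδ, ← integral_indicator Metric.isOpen_ball.measurableSet,
    ← integral_indicator Metric.isOpen_ball.measurableSet, 
    ← integral_sub_right_eq_self ((Metric.ball 0 δ).indicator _) x]
  congr 1
  ext y
  simp only [Set.indicator, Metric.mem_ball, dist_eq_norm, sub_zero, norm_sub_rev x y]

/-- The integrand is odd under the reflection `y ↦ 2x - y`, which preserves the annulus. This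
removes first-order terms from principal values. -/
theorem setIntegral_annulus_inner_div_eq_zero (a : ℝ) (b x : EuclideanSpace ℝ (Fin N))
    (ε δ : ℝ) :
    ∫ y in Metric.ball x δ \ Metric.ball x ε, inner ℝ b (y - x) / ‖x - y‖ ^ a = 0 := by
  have hm : MeasurableSet (Metric.ball x δ \ Metric.ball x ε) :=
    Metric.isOpen_ball.measurableSet.diff Metric.isOpen_ball.measurableSet
  rw [← integral_indicator hm]
  have h := integral_sub_left_eq_self ((Metric.ball x δ \ Metric.ball x ε).indicator
    fun y => inner ℝ b (y - x) / ‖x - y‖ ^ a) volume (x + x)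
  have h2 : (fun y => (Metric.ball x δ \ Metric.ball x ε).indicator
      (fun y => inner ℝ b (y - x) / ‖x - y‖ ^ a) (x + x - y)) =
      fun y => -(Metric.ball x δ \ Metric.ball x ε).indicator
        (fun y => inner ℝ b (y - x) / ‖x - y‖ ^ a) y := by
    ext y
    have e1 : x + x - y - x = -(y - x) := by abel
    have e2 : x - (x + x - y) = -(x - y) := by abel
    simp only [Set.indicator, Set.mem_sdiff, Metric.mem_ball, dist_eq_norm, e1, e2, norm_neg,
      inner_neg_right]
    split_ifs <;> ring
  rw [h2, integral_neg] at h
  linarith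

theorem integrableOn_annulus_inner_div {a : ℝ} (ha : 0 ≤ a) (b x : EuclideanSpace ℝ (Fin N))
    {ε δ : ℝ} (hε : 0 < ε) :
    IntegrableOn (fun y => inner ℝ b (y - x) / ‖x - y‖ ^ a)
      (Metric.ball x δ \ Metric.ball x ε) := by
  have hm : MeasurableSet (Metric.ball x δ \ Metric.ball x ε) :=
    Metric.isOpen_ball.measurableSet.diff Metric.isOpen_ball.measurableSet
  refine Measure.integrableOn_of_bounded (M := ‖b‖ * δ / ε ^ a) ?_ ?_ ?_
  · exact ((measure_mono Set.sdiff_subset).trans_lt measure_ball_lt_top).ne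
  · exact Measurable.aestronglyMeasurable (by fun_prop)
  · refine (ae_restrict_iff' hm).2 (.of_forall fun y hy => ?_)
    have h1 : ‖y - x‖ < δ := by simpa [dist_eq_norm] using hy.1
    have h2 : ε ≤ ‖x - y‖ := by simpa [dist_eq_norm, norm_sub_rev] using hy.2
    rw [norm_div, Real.norm_of_nonneg (Real.rpow_nonneg (norm_nonneg _) _)]
    have h0 : 0 ≤ δ := (norm_nonneg _).trans h1.le
    gcongr
    exact (norm_inner_le_norm _ _).trans (by gcongr)

/-- A principal value is bounded below when the increment is bounded below by a quadratic
polynomial without constant term near the singularity and by `-V` away from it. -/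
theorem le_of_tendsto_principalValue (hN : 1 ≤ N) {s : ℝ} (hs0 : 0 < s) (hs1 : s < 1)
    {G V : EuclideanSpace ℝ (Fin N) → ℝ} {x b : EuclideanSpace ℝ (Fin N)} {A δ L : ℝ}
    (hδ : 0 < δ) (hA : 0 ≤ A)
    (hG : ∀ ε > 0, IntegrableOn (fun y => G y / ‖x - y‖ ^ ((N : ℝ) + 2 * s)) (Metric.ball x ε)ᶜ)
    (hV : IntegrableOn (fun y => V y / ‖x - y‖ ^ ((N : ℝ) + 2 * s)) (Metric.ball x δ)ᶜ)
    (hL : Tendsto (fun ε : ℝ => ∫ y in (Metric.ball x ε)ᶜ, G y / ‖x - y‖ ^ ((N : ℝ) + 2 * s))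
      (𝓝[>] 0) (𝓝 L))
    (hin : ∀ y ∈ Metric.ball x δ, -inner ℝ b (y - x) - A * ‖y - x‖ ^ 2 ≤ G y)
    (hout : ∀ y ∉ Metric.ball x δ, -V y ≤ G y) :
    -(A * (δ ^ (2 - 2 * s) * ∫ z in Metric.ball (0 : EuclideanSpace ℝ (Fin N)) 1,
        ‖z‖ ^ 2 / ‖z‖ ^ ((N : ℝ) + 2 * s)))
      - ∫ y in (Metric.ball x δ)ᶜ, V y / ‖x - y‖ ^ ((N : ℝ) + 2 * s) ≤ L := by
  refine ge_of_tendsto hL ?_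
  filter_upwards [Ioo_mem_nhdsGT hδ] with ε hε
  have hmδ : MeasurableSet (Metric.ball x δ) := Metric.isOpen_ball.measurableSet
  have hm : MeasurableSet (Metric.ball x δ \ Metric.ball x ε) :=
    hmδ.diff Metric.isOpen_ball.measurableSet
  have hsub : Metric.ball x ε ⊆ Metric.ball x δ := Metric.ball_subset_ball hε.2.le
  have hunion : (Metric.ball x ε)ᶜ = (Metric.ball x δ \ Metric.ball x ε) ∪ (Metric.ball x δ)ᶜ := by
    ext y
    have := @hsub y
    simp only [Set.mem_compl_iff, Set.mem_union, Set.mem_sdiff]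
    tauto
  have hdisj : Disjoint (Metric.ball x δ \ Metric.ball x ε) (Metric.ball x δ)ᶜ :=
    Set.disjoint_left.2 fun y hy hy' => hy' hy.1
  have hGε := hG ε hε.1
  have hGa := hGε.mono_set (hunion ▸ Set.subset_union_left)
  have hGc := hG δ hδ
  rw [hunion, setIntegral_union hdisj hmδ.compl hGa hGc]
  have hquad := integrableOn_ball_sq_div_rpow_norm_sub hN hs1 x δ
  have hquada : IntegrableOn (fun y => ‖y - x‖ ^ 2 / ‖x - y‖ ^ ((N : ℝ) + 2 * s))
    (Metric.ball x δ \ Metric.ball x ε) := hquad.mono_set Set.sdiff_subset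
  have hlin := integrableOn_annulus_inner_div (a := (N : ℝ) + 2 * s) (by positivity) b x (δ := δ)
    hε.1
  have h1 : -(A * (δ ^ (2 - 2 * s) * ∫ z in Metric.ball (0 : EuclideanSpace ℝ (Fin N)) 1,
        ‖z‖ ^ 2 / ‖z‖ ^ ((N : ℝ) + 2 * s))) ≤
      ∫ y in Metric.ball x δ \ Metric.ball x ε, G y / ‖x - y‖ ^ ((N : ℝ) + 2 * s) := by
    rw [← integral_ball_sq_div_rpow_norm_sub s x hδ]
    have h2 : ∫ y in Metric.ball x δ \ Metric.ball x ε,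
        (-(inner ℝ b (y - x) / ‖x - y‖ ^ ((N : ℝ) + 2 * s)) -
          A * (‖y - x‖ ^ 2 / ‖x - y‖ ^ ((N : ℝ) + 2 * s))) ≤
        ∫ y in Metric.ball x δ \ Metric.ball x ε, G y / ‖x - y‖ ^ ((N : ℝ) + 2 * s) := by
      refine setIntegral_mono_on (hlin.neg.sub (hquada.const_mul A)) hGa hm fun y hy => ?_
      have := div_le_div_of_nonneg_right (hin y hy.1)
        (Real.rpow_nonneg (norm_nonneg (x - y)) ((N : ℝ) + 2 * s))
      refine le_trans (le_of_eq ?_) this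
      ring
    rw [integral_sub hlin.fun_neg (hquada.const_mul A), integral_neg,
      setIntegral_annulus_inner_div_eq_zero, integral_const_mul] at h2
    have h3 : ∫ y in Metric.ball x δ \ Metric.ball x ε,
        ‖y - x‖ ^ 2 / ‖x - y‖ ^ ((N : ℝ) + 2 * s) ≤
        ∫ y in Metric.ball x δ, ‖y - x‖ ^ 2 / ‖x - y‖ ^ ((N : ℝ) + 2 * s) :=
      setIntegral_mono_set hquad (.of_forall fun y => by simp only [Pi.zero_apply]; positivity)
        (.of_forall Set.sdiff_subset)
    have := mul_le_mul_of_nonneg_left h3 hA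
    linarith
  have h4 : -∫ y in (Metric.ball x δ)ᶜ, V y / ‖x - y‖ ^ ((N : ℝ) + 2 * s) ≤
      ∫ y in (Metric.ball x δ)ᶜ, G y / ‖x - y‖ ^ ((N : ℝ) + 2 * s) := by
    rw [← integral_neg]
    refine setIntegral_mono_on hV.neg hGc hmδ.compl fun y hy => ?_
    have := div_le_div_of_nonneg_right (hout y hy)
      (Real.rpow_nonneg (norm_nonneg (x - y)) ((N : ℝ) + 2 * s))
    refine le_trans (le_of_eq ?_) this
    ring
  linarith

end Kernel

end FracLaneEmden

namespace FracLaneEmden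

/-! ### Integrability and decay of the weighted tail. -/

section Tail

variable {N : ℕ}

theorem memWeightedL1_const {s : ℝ} (hs0 : 0 < s) (c : ℝ) :
    MemWeightedL1 s (fun _ : EuclideanSpace ℝ (Fin N) => c) := by
  have h := integrable_one_add_norm (E := EuclideanSpace ℝ (Fin N)) (μ := volume)
    (r := (N : ℝ) + 2 * s) (by rw [finrank_euclideanSpace, Fintype.card_fin]; linarith)
  refine (h.const_mul c).congr (.of_forall fun y => ?_)
  simp only [Real.rpow_neg (by positivity : (0 : ℝ) ≤ 1 + ‖y‖), div_eq_mul_inv]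

theorem MemWeightedL1.sub {s : ℝ} {f g : EuclideanSpace ℝ (Fin N) → ℝ}
    (hf : MemWeightedL1 s f) (hg : MemWeightedL1 s g) :
    MemWeightedL1 s (fun y => f y - g y) := by
  refine (Integrable.sub hf hg).congr (.of_forall fun y => ?_)
  simp only [Pi.sub_apply, sub_div]

theorem MemWeightedL1.const_mul {s : ℝ} {f : EuclideanSpace ℝ (Fin N) → ℝ}
    (hf : MemWeightedL1 s f) (c : ℝ) : MemWeightedL1 s (fun y => c * f y) := by
  refine (Integrable.const_mul hf c).congr (.of_forall fun y => ?_)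
  simp only [mul_div_assoc]

/-- Any weight `ρ` comparable from below to `1 + ‖y‖` can replace it; this covers both `‖x - y‖` off
a ball and `R + ‖y - z‖`. -/
theorem MemWeightedL1.integrableOn_div_rpow {s : ℝ} (hs0 : 0 < s)
    {f ρ : EuclideanSpace ℝ (Fin N) → ℝ} (hf : MemWeightedL1 s f) (hfm : Measurable f)
    (hρm : Measurable ρ) {K : ℝ} {S : Set (EuclideanSpace ℝ (Fin N))} (hS : MeasurableSet S)
    (hK : 0 ≤ K) (hρ : ∀ y ∈ S, 1 + ‖y‖ ≤ K * ρ y) :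
    IntegrableOn (fun y => f y / ρ y ^ ((N : ℝ) + 2 * s)) S := by
  have ha : 0 ≤ (N : ℝ) + 2 * s := by positivity
  refine Integrable.mono' ((Integrable.norm hf).const_mul
    (K ^ ((N : ℝ) + 2 * s))).integrableOn
    (Measurable.aestronglyMeasurable (by fun_prop)) ?_
  refine (ae_restrict_iff' hS).2 (.of_forall fun y hy => ?_)
  have h := hρ y hy
  have hy1 : 0 < 1 + ‖y‖ := by positivity
  have hρ0 : 0 < ρ y := by
    by_contra hcon
    nlinarith [mul_nonneg hK (neg_nonneg.2 (not_lt.1 hcon))]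
  have hpow := Real.rpow_le_rpow hy1.le h ha
  rw [Real.mul_rpow hK hρ0.le] at hpow
  rw [norm_div, norm_div, Real.norm_of_nonneg (Real.rpow_nonneg hρ0.le _),
    Real.norm_of_nonneg (Real.rpow_nonneg hy1.le _), ← mul_div_assoc,
    div_le_div_iff₀ (Real.rpow_pos_of_pos hρ0 _) (Real.rpow_pos_of_pos hy1 _)]
  nlinarith [mul_le_mul_of_nonneg_left hpow (norm_nonneg (f y))]

theorem MemWeightedL1.integrableOn_compl_ball {s : ℝ} (hs0 : 0 < s)
    {f : EuclideanSpace ℝ (Fin N) → ℝ} (hf : MemWeightedL1 s f) (hfm : Measurable f)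
    (x : EuclideanSpace ℝ (Fin N)) {ε : ℝ} (hε : 0 < ε) :
    IntegrableOn (fun y => f y / ‖x - y‖ ^ ((N : ℝ) + 2 * s)) (Metric.ball x ε)ᶜ := by
  refine hf.integrableOn_div_rpow hs0 (ρ := fun y => ‖x - y‖) hfm (by fun_prop)
    Metric.isOpen_ball.measurableSet.compl (K := (1 + ‖x‖) / ε + 1) (by positivity) fun y hy => ?_
  have h1 : ε ≤ ‖x - y‖ := by simpa [dist_eq_norm, norm_sub_rev] using hy
  have h2 : ‖y‖ ≤ ‖x‖ + ‖x - y‖ := by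
    have := norm_sub_le x (x - y)
    rwa [sub_sub_cancel] at this
  have h3 : 1 + ‖x‖ ≤ (1 + ‖x‖) / ε * ‖x - y‖ := by
    rw [div_mul_eq_mul_div, le_div_iff₀ hε]
    gcongr
  linarith

theorem MemWeightedL1.integrable_div_add_norm_sub {s : ℝ} (hs0 : 0 < s)
    {f : EuclideanSpace ℝ (Fin N) → ℝ} (hf : MemWeightedL1 s f) (hfm : Measurable f)
    (z : EuclideanSpace ℝ (Fin N)) {R : ℝ} (hR : 1 ≤ R) :
    Integrable (fun y => f y / (R + ‖y - z‖) ^ ((N : ℝ) + 2 * s)) := by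
  rw [← integrableOn_univ]
  refine hf.integrableOn_div_rpow hs0 (ρ := fun y => R + ‖y - z‖) hfm (by fun_prop)
    MeasurableSet.univ (K := 1 + ‖z‖) (by positivity) fun y _ => ?_
  have h2 : ‖y‖ ≤ ‖y - z‖ + ‖z‖ := by simpa using norm_add_le (y - z) z
  nlinarith [norm_nonneg z, norm_nonneg (y - z)]

theorem MemWeightedL1.tendsto_integral_div_add_norm_sub {s : ℝ} (hs0 : 0 < s)
    {f : EuclideanSpace ℝ (Fin N) → ℝ} (hf : MemWeightedL1 s f) (hfm : Measurable f)
    (z : EuclideanSpace ℝ (Fin N)) :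
    Tendsto (fun R : ℝ => ∫ y, f y / (R + ‖y - z‖) ^ ((N : ℝ) + 2 * s)) atTop (𝓝 0) := by
  have ha : 0 < (N : ℝ) + 2 * s := by positivity
  have h := tendsto_integral_filter_of_dominated_convergence (μ := volume) (l := atTop)
    (F := fun (R : ℝ) y => f y / (R + ‖y - z‖) ^ ((N : ℝ) + 2 * s)) (f := fun _ => (0 : ℝ))
    (fun y => ‖f y / (1 + ‖y - z‖) ^ ((N : ℝ) + 2 * s)‖)
    (.of_forall fun R => Measurable.aestronglyMeasurable (by fun_prop)) ?_
    (hf.integrable_div_add_norm_sub hs0 hfm z le_rfl).norm ?_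
  · simpa using h
  · filter_upwards [eventually_ge_atTop 1] with R hR
    refine .of_forall fun y => ?_
    have hR0 : 0 < R := by linarith
    have h1 : 0 ≤ (R + ‖y - z‖) ^ ((N : ℝ) + 2 * s) := by positivity
    have h2 : 0 ≤ (1 + ‖y - z‖) ^ ((N : ℝ) + 2 * s) := by positivity
    rw [norm_div, norm_div, Real.norm_of_nonneg h1, Real.norm_of_nonneg h2]
    gcongr
  · refine .of_forall fun y => ?_
    refine Tendsto.div_atTop tendsto_const_nhds ((tendsto_rpow_atTop ha).comp ?_)
    exact tendsto_atTop_add_const_right _ _ tendsto_id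

theorem setIntegral_compl_ball_div_le {s : ℝ} (hs0 : 0 < s)
    {f : EuclideanSpace ℝ (Fin N) → ℝ} (hf : MemWeightedL1 s f) (hfm : Measurable f)
    (hf0 : ∀ y, 0 ≤ f y) (x z : EuclideanSpace ℝ (Fin N)) {δ R K : ℝ} (hδ : 0 < δ) (hR : 1 ≤ R)
    (hK : 0 ≤ K) (hKy : ∀ y ∉ Metric.ball x δ, R + ‖y - z‖ ≤ K * ‖x - y‖) :
    ∫ y in (Metric.ball x δ)ᶜ, f y / ‖x - y‖ ^ ((N : ℝ) + 2 * s) ≤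
      K ^ ((N : ℝ) + 2 * s) * ∫ y, f y / (R + ‖y - z‖) ^ ((N : ℝ) + 2 * s) := by
  have ha : 0 ≤ (N : ℝ) + 2 * s := by positivity
  have hi := (hf.integrable_div_add_norm_sub hs0 hfm z hR).const_mul (K ^ ((N : ℝ) + 2 * s))
  rw [← integral_const_mul]
  refine le_trans (setIntegral_mono_on (hf.integrableOn_compl_ball hs0 hfm x hδ) hi.integrableOn
    Metric.isOpen_ball.measurableSet.compl fun y hy => ?_)
    (setIntegral_le_integral hi (.of_forall fun y => ?_))
  · have h1 : δ ≤ ‖x - y‖ := by simpa [dist_eq_norm, norm_sub_rev] using hy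
    have hy0 : 0 < R + ‖y - z‖ := by positivity
    have hpow := Real.rpow_le_rpow hy0.le (hKy y hy) ha
    rw [Real.mul_rpow hK (norm_nonneg _)] at hpow
    rw [← mul_div_assoc, div_le_div_iff₀ (Real.rpow_pos_of_pos (hδ.trans_le h1) _)
      (Real.rpow_pos_of_pos hy0 _)]
    nlinarith [mul_le_mul_of_nonneg_left hpow (hf0 y)]
  · have := hf0 y
    simp only [Pi.zero_apply]
    positivity

end Tail

/-! ### Scalar inequalities. -/

section Inequalities

theorem exists_inv_pow_le (n : ℕ) : ∃ C : ℝ, 0 ≤ C ∧ ∀ r : ℝ, |r - 1| ≤ 1 / 2 →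
    (r ^ n)⁻¹ ≤ 1 + n * (1 - r) + C * (r - 1) ^ 2 := by
  induction n with
  | zero => exact ⟨0, le_rfl, fun r _ => by simp⟩
  | succ n ih =>
    obtain ⟨C, hC, h⟩ := ih
    -- Chosen so that the bracket `2 (C + n + 1) r - (n + 1) - C` is nonnegative for `r ≥ 1/2`, with
    -- equality at `1/2`.
    refine ⟨2 * (C + n + 1), by positivity, fun r hr => ?_⟩
    have hr' := abs_le.1 hr
    have hr0 : 0 < r := by linarith
    have h1 := h r hr
    rw [pow_succ, mul_inv, ← div_eq_mul_inv, div_le_iff₀ hr0]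
    refine h1.trans ?_
    push_cast
    have key : (1 + ((n : ℝ) + 1) * (1 - r) + 2 * (C + n + 1) * (r - 1) ^ 2) * r -
        (1 + n * (1 - r) + C * (r - 1) ^ 2) =
        (r - 1) ^ 2 * (2 * (C + n + 1) * r - (n + 1) - C) := by ring
    have h3 : 0 ≤ 2 * (C + n + 1) * r - (n + 1) - C := by
      have : (0 : ℝ) ≤ n := n.cast_nonneg
      nlinarith
    nlinarith [mul_nonneg (sq_nonneg (r - 1)) h3]

/-- The graph of a concave power lies below its tangent at `a`; this is Bernoulli's inequality for
`b / a`. -/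
theorem rpow_le_add_mul_sub {τ a b : ℝ} (hτ0 : 0 ≤ τ) (hτ1 : τ ≤ 1) (ha : 0 < a) (hb : 0 < b) :
    b ^ τ ≤ a ^ τ + τ * a ^ (τ - 1) * (b - a) := by
  have h := rpow_one_add_le_one_add_mul_self (s := b / a - 1)
    (by have := div_pos hb ha; linarith) hτ0 hτ1
  have e : 1 + (b / a - 1) = b / a := by ring
  rw [e, Real.div_rpow hb.le ha.le, div_le_iff₀ (Real.rpow_pos_of_pos ha _)] at h
  refine h.trans (le_of_eq ?_)
  rw [Real.rpow_sub_one ha.ne']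
  field_simp

/-- The reaction terms of the Lane-Emden system absorb a power of `b v - u^τ`. -/
theorem reaction_le_neg_rpow {p τ b u v : ℝ} (hp : 1 < p) (hτ1 : τ ≤ 1)
    (hτp : 1 < τ * p) (hb : 0 < b) (hbτ : b ^ (p + 1) = τ) (hu : 0 < u) (hv : 0 < v)
    (hW : 0 < b * v - u ^ τ) :
    b * u ^ (τ * (p + 1) - 1) - τ * u ^ (τ - 1) * v ^ p ≤
      -(b * (b * v - u ^ τ) ^ (p + 1 - 1 / τ)) := by
  have hτ0 : 0 < τ := hbτ ▸ Real.rpow_pos_of_pos hb _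
  set X := u ^ τ with hX
  set V := b * v with hV
  have hX0 : 0 < X := Real.rpow_pos_of_pos hu _
  have hV0 : 0 < V := mul_pos hb hv
  have e1 : u ^ (τ * (p + 1) - 1) = u ^ (τ - 1) * X ^ p := by
    rw [hX, ← Real.rpow_mul hu.le, ← Real.rpow_add hu]
    congr 1
    ring
  have e2 : τ * v ^ p = b * V ^ p := by
    rw [hV, Real.mul_rpow hb.le hv.le, ← hbτ, Real.rpow_add_one hb.ne']
    ring
  have e3 : u ^ (τ - 1) = X ^ (1 - 1 / τ) := by
    rw [hX, ← Real.rpow_mul hu.le]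
    congr 1
    field_simp
  have e4 : 1 - 1 / τ ≤ 0 := by
    have : 1 ≤ 1 / τ := by rw [le_div_iff₀ hτ0]; linarith
    linarith
  -- The exponent is nonpositive and `X < V`, so the singular factor `u^(τ-1)` only helps.
  have e5 : V ^ (1 - 1 / τ) ≤ X ^ (1 - 1 / τ) :=
    Real.rpow_le_rpow_of_nonpos hX0 (by linarith) e4
  have e6 : X ^ p ≤ X * V ^ (p - 1) := by
    have h1 : X ^ p = X * X ^ (p - 1) := by
      rw [mul_comm, ← Real.rpow_add_one hX0.ne']
      congr 1
      ring
    rw [h1]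
    gcongr
    linarith
  have e7 : V ^ p = V * V ^ (p - 1) := by
    rw [mul_comm, ← Real.rpow_add_one hV0.ne']
    congr 1
    ring
  -- The exponent is `1 + (p - 1/τ)` with `p - 1/τ > 0`, and `V - X ≤ V`.
  have e8 : (V - X) ^ (p + 1 - 1 / τ) ≤ V ^ (1 - 1 / τ) * V ^ (p - 1) * (V - X) := by
    rw [← Real.rpow_add hV0, show p + 1 - 1 / τ = (1 - 1 / τ + (p - 1)) + 1 by ring,
      Real.rpow_add_one hW.ne']
    have : 1 / τ < p := by rw [div_lt_iff₀ hτ0]; linarith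
    gcongr
    · linarith
    · linarith
  have e9 : V ^ (1 - 1 / τ) * V ^ (p - 1) * (V - X) ≤ X ^ (1 - 1 / τ) * (V ^ p - X ^ p) := by
    have h0 : V ^ (p - 1) * (V - X) ≤ V ^ p - X ^ p := by linarith
    have h1 : 0 ≤ V ^ (p - 1) * (V - X) := mul_nonneg (Real.rpow_nonneg hV0.le _) hW.le
    rw [mul_assoc]
    exact mul_le_mul e5 h0 h1 (Real.rpow_nonneg hX0.le _)
  have e10 := mul_le_mul_of_nonneg_left (e8.trans e9) hb.le
  have e11 : τ * u ^ (τ - 1) * v ^ p = u ^ (τ - 1) * (b * V ^ p) := by rw [← e2]; ring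
  rw [e11, e1, e3]
  linarith

end Inequalities

end FracLaneEmden

namespace FracLaneEmden

/-! ### Touching by a bump function of radius `R`. -/

section Contact

variable {N : ℕ}

/-- Second-order expansion of the inverse bump, uniform at the natural scale `R t`. The linear
coefficient `B` is left unspecified because its contribution cancels by symmetry. -/
theorem exists_bump_pow_le (n : ℕ) : ∃ K : ℝ, 0 ≤ K ∧
    ∀ (x z : EuclideanSpace ℝ (Fin N)) (R t : ℝ), 0 < R → 0 < t → t = 1 - ‖x - z‖ ^ 2 / R ^ 2 →
      ∃ B : EuclideanSpace ℝ (Fin N), ∀ y, ‖y - x‖ < R * t / 6 →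
        0 < 1 - ‖y - z‖ ^ 2 / R ^ 2 ∧
        t ^ n ≤ (1 - ‖y - z‖ ^ 2 / R ^ 2) ^ n *
          (1 + inner ℝ B (y - x) + K / (R * t) ^ 2 * ‖y - x‖ ^ 2) := by
  obtain ⟨C, hC, hpow⟩ := exists_inv_pow_le n
  -- `n` comes from the quadratic part of `n (1 - r)`, and `9 C` from `|r - 1| ≤ 3‖e‖/(R t)`.
  refine ⟨n + 9 * C, by positivity, fun x z R t hR ht htx =>
    ⟨((2 * n) / (R ^ 2 * t)) • (x - z), fun y hy => ?_⟩⟩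
  set e := y - x with he
  have ht1 : t ≤ 1 := by rw [htx]; have : 0 ≤ ‖x - z‖ ^ 2 / R ^ 2 := by positivity
                         linarith
  have hxz : ‖x - z‖ ≤ R := by
    have h : ‖x - z‖ ^ 2 / R ^ 2 < 1 := by linarith
    rw [div_lt_one (by positivity)] at h
    exact (le_abs_self _).trans (abs_le_of_sq_le_sq h.le hR.le)
  have hRt : 0 < R * t := by positivity
  have hyz : ‖y - z‖ ^ 2 = ‖x - z‖ ^ 2 + 2 * inner ℝ (x - z) e + ‖e‖ ^ 2 := by
    rw [← norm_add_sq_real]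
    congr 2
    rw [he]
    abel
  set T := 1 - ‖y - z‖ ^ 2 / R ^ 2 with hT
  set r := T / t with hr
  have h1r : 1 - r = (2 * inner ℝ (x - z) e + ‖e‖ ^ 2) / (R ^ 2 * t) := by
    have hT2 : T = t - (2 * inner ℝ (x - z) e + ‖e‖ ^ 2) / R ^ 2 := by
      rw [hT, htx, hyz]
      ring
    rw [hr, hT2]
    field_simp
    ring
  have heR : ‖e‖ ≤ R := by nlinarith
  have hin : |inner ℝ (x - z) e| ≤ R * ‖e‖ :=
    (abs_real_inner_le_norm _ _).trans (by gcongr)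
  have hnum : |2 * inner ℝ (x - z) e + ‖e‖ ^ 2| ≤ 3 * R * ‖e‖ := by
    have h2 := abs_le.1 hin
    have h3 : ‖e‖ ^ 2 ≤ R * ‖e‖ := by nlinarith [norm_nonneg e]
    rw [abs_le]
    constructor <;> nlinarith [sq_nonneg ‖e‖]
  have habs : |r - 1| ≤ 3 * ‖e‖ / (R * t) := by
    rw [abs_sub_comm, h1r, abs_div, abs_of_pos (by positivity : 0 < R ^ 2 * t),
      div_le_div_iff₀ (by positivity) hRt]
    have := mul_le_mul_of_nonneg_right hnum hRt.le
    nlinarith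
  -- This is where the radius `R t / 6` is needed.
  have hhalf : |r - 1| ≤ 1 / 2 := by
    refine habs.trans ?_
    rw [div_le_iff₀ hRt]
    linarith
  have hr0 : 0 < r := by linarith [(abs_le.1 hhalf).1]
  have hTpos : 0 < T := by
    have : T = r * t := by rw [hr]; field_simp
    rw [this]
    positivity
  refine ⟨hTpos, ?_⟩
  have hsq : (r - 1) ^ 2 ≤ 9 * (‖e‖ ^ 2 / (R * t) ^ 2) := by
    have h4 : (r - 1) ^ 2 ≤ (3 * ‖e‖ / (R * t)) ^ 2 := by
      rw [← sq_abs]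
      gcongr
    refine h4.trans (le_of_eq ?_)
    ring
  have hlin : 1 - r ≤ 2 * inner ℝ (x - z) e / (R ^ 2 * t) + ‖e‖ ^ 2 / (R * t) ^ 2 := by
    rw [h1r, add_div]
    gcongr
    nlinarith [mul_nonneg (sq_nonneg R) (mul_nonneg ht.le (sub_nonneg.2 ht1))]
  have hmain : (r ^ n)⁻¹ ≤
      1 + inner ℝ (((2 * n) / (R ^ 2 * t)) • (x - z)) e
        + (n + 9 * C) / (R * t) ^ 2 * ‖e‖ ^ 2 := by
    refine (hpow r hhalf).trans ?_
    rw [real_inner_smul_left]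
    have h5 := mul_le_mul_of_nonneg_left hlin (n.cast_nonneg (α := ℝ))
    have h6 := mul_le_mul_of_nonneg_left hsq hC
    have e5 : (n : ℝ) * (2 * inner ℝ (x - z) e / (R ^ 2 * t) + ‖e‖ ^ 2 / (R * t) ^ 2) =
      2 * n / (R ^ 2 * t) * inner ℝ (x - z) e + n / (R * t) ^ 2 * ‖e‖ ^ 2 := by ring
    have e6 : (n + 9 * C) / (R * t) ^ 2 * ‖e‖ ^ 2 =
      n / (R * t) ^ 2 * ‖e‖ ^ 2 + C * (9 * (‖e‖ ^ 2 / (R * t) ^ 2)) := by ring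
    linarith
  calc t ^ n = T ^ n * (r ^ n)⁻¹ := by
        rw [hr, div_pow, inv_div]
        field_simp
    _ ≤ _ := by gcongr

/-- Lower bound for the principal value at a point where `W` times a bump function of radius `R`
is maximal. -/
theorem exists_contact_estimate (hN : 1 ≤ N) {s : ℝ} (hs0 : 0 < s) (hs1 : s < 1) (n : ℕ) :
    ∃ C : ℝ, 0 < C ∧ ∀ (x z : EuclideanSpace ℝ (Fin N)) (R t : ℝ)
      (W G V : EuclideanSpace ℝ (Fin N) → ℝ) (L : ℝ),
      1 ≤ R → 0 < t → t = 1 - ‖x - z‖ ^ 2 / R ^ 2 →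
      (∀ ε > 0, IntegrableOn (fun y => G y / ‖x - y‖ ^ ((N : ℝ) + 2 * s)) (Metric.ball x ε)ᶜ) →
      MemWeightedL1 s V → Measurable V → (∀ y, 0 ≤ V y) →
      Tendsto (fun ε : ℝ => ∫ y in (Metric.ball x ε)ᶜ, G y / ‖x - y‖ ^ ((N : ℝ) + 2 * s))
        (𝓝[>] 0) (𝓝 L) →
      (∀ y, W x - W y ≤ G y) → (∀ y, -V y ≤ G y) → 0 < W x →
      (∀ y ∈ Metric.closedBall z R, W y * (1 - ‖y - z‖ ^ 2 / R ^ 2) ^ n ≤ W x * t ^ n) →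
      -(C * (W x * (R * t) ^ (-(2 * s)) + t ^ (-((N : ℝ) + 2 * s)) *
        ∫ y, V y / (R + ‖y - z‖) ^ ((N : ℝ) + 2 * s))) ≤ L := by
  obtain ⟨K, hK, hbump⟩ := exists_bump_pow_le (N := N) n
  set J := ∫ z in Metric.ball (0 : EuclideanSpace ℝ (Fin N)) 1,
        ‖z‖ ^ 2 / ‖z‖ ^ ((N : ℝ) + 2 * s) with hJ
  have hJ0 : 0 ≤ J := integral_nonneg fun z => by simp only [Pi.zero_apply]; positivity
  refine ⟨K * (1 / 6) ^ (2 - 2 * s) * J + 13 ^ ((N : ℝ) + 2 * s), by positivity, ?_⟩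
  intro x z R t W G V L hR ht htx hG hV hVm hV0 hL hWG hVG hWx hmax
  have hR0 : 0 < R := by linarith
  have hRt : 0 < R * t := by positivity
  have ht1 : t ≤ 1 := by
    have : 0 ≤ ‖x - z‖ ^ 2 / R ^ 2 := by positivity
    linarith
  have hxz : ‖x - z‖ ≤ R := by
    have h : ‖x - z‖ ^ 2 / R ^ 2 < 1 := by linarith
    rw [div_lt_one (by positivity)] at h
    exact (le_abs_self _).trans (abs_le_of_sq_le_sq h.le hR0.le)
  have hδ : 0 < R * t / 6 := by positivity
  obtain ⟨B, hB⟩ := hbump x z R t hR0 ht htx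
  have h1 := le_of_tendsto_principalValue hN hs0 hs1 (b := W x • B) (A := W x * (K / (R * t) ^ 2))
    hδ (by positivity) hG (hV.integrableOn_compl_ball hs0 hVm x hδ) hL
    (fun y hy => ?_) (fun y _ => hVG y)
  -- Off the ball, `R ≤ (6/t)‖x - y‖`, so `R + ‖y - z‖ ≤ 2R + ‖x - y‖ ≤ (13/t)‖x - y‖`.
  · have h2 := setIntegral_compl_ball_div_le hs0 hV hVm hV0 x z hδ hR (K := 13 / t)
      (by positivity) (fun y hy => ?_)
    · set I := ∫ y, V y / (R + ‖y - z‖) ^ ((N : ℝ) + 2 * s) with hI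
      have hI0 : 0 ≤ I := integral_nonneg fun y => by
        have := hV0 y
        simp only [Pi.zero_apply]
        positivity
      have e1 : (13 / t) ^ ((N : ℝ) + 2 * s) =
          13 ^ ((N : ℝ) + 2 * s) * t ^ (-((N : ℝ) + 2 * s)) := by
        rw [Real.div_rpow (by norm_num) ht.le, Real.rpow_neg ht.le, div_eq_mul_inv]
      have e2 : W x * (K / (R * t) ^ 2) * ((R * t / 6) ^ (2 - 2 * s) * J) =
          K * (1 / 6) ^ (2 - 2 * s) * J * (W x * (R * t) ^ (-(2 * s))) := by
        have e3 : (R * t / 6) ^ (2 - 2 * s) =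
            (R * t) ^ 2 * (R * t) ^ (-(2 * s)) * (1 / 6) ^ (2 - 2 * s) := by
          rw [div_eq_mul_one_div, Real.mul_rpow hRt.le (by norm_num), sub_eq_add_neg,
            Real.rpow_add hRt, Real.rpow_two]
        rw [e3]
        field_simp
      rw [e1] at h2
      rw [← hJ, e2] at h1
      have p1 : 0 ≤ K * (1 / 6) ^ (2 - 2 * s) * J * (t ^ (-((N : ℝ) + 2 * s)) * I) := by
        positivity
      have p2 : 0 ≤ 13 ^ ((N : ℝ) + 2 * s) * (W x * (R * t) ^ (-(2 * s))) := by positivity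
      nlinarith
    · have h3 : R * t / 6 ≤ ‖x - y‖ := by simpa [dist_eq_norm, norm_sub_rev] using hy
      have h4 : ‖y - z‖ ≤ ‖x - y‖ + ‖x - z‖ := by
        have := norm_add_le (y - x) (x - z)
        rwa [sub_add_sub_cancel, norm_sub_rev y x] at this
      have h5 : R ≤ 6 / t * ‖x - y‖ := by
        rw [div_mul_eq_mul_div, le_div_iff₀ ht]
        linarith
      have h6 : ‖x - y‖ ≤ 1 / t * ‖x - y‖ := by
        rw [div_mul_eq_mul_div, le_div_iff₀ ht]
        nlinarith [norm_nonneg (x - y)]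
      have e : 13 / t * ‖x - y‖ = 2 * (6 / t * ‖x - y‖) + 1 / t * ‖x - y‖ := by ring
      linarith
  · obtain ⟨hy0, hyn⟩ := hB y (by simpa [dist_eq_norm] using hy)
    have hymem : y ∈ Metric.closedBall z R := by
      have h : ‖y - z‖ ^ 2 / R ^ 2 < 1 := by linarith
      rw [div_lt_one (by positivity)] at h
      rw [Metric.mem_closedBall, dist_eq_norm]
      exact (le_abs_self _).trans (abs_le_of_sq_le_sq h.le hR0.le)
    have h7 := (hmax y hymem).trans (mul_le_mul_of_nonneg_left hyn hWx.le)
    have h8 : W y ≤ W x * (1 + inner ℝ B (y - x) + K / (R * t) ^ 2 * ‖y - x‖ ^ 2) := by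
      refine le_of_mul_le_mul_right (h7.trans (le_of_eq ?_)) (pow_pos hy0 n)
      ring
    have h9 := hWG y
    rw [real_inner_smul_left]
    linarith

end Contact

end FracLaneEmden

namespace FracLaneEmden

/-! ### Absorption and the comparison of `u` and `v`. -/

section Comparison

variable {N : ℕ}

theorem normConst_pos {N : ℕ} {s : ℝ} (hs0 : 0 < s) (hs1 : s < 1) : 0 < normConst N s := by
  unfold normConst
  have h1 : 0 < Real.Gamma ((N : ℝ) / 2 + s) := Real.Gamma_pos_of_pos (by positivity)
  have h2 : 0 < Real.Gamma (1 - s) := Real.Gamma_pos_of_pos (by linarith)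
  have := Real.pi_pos
  positivity

theorem MemSolutionClass.continuous {s : ℝ} {u : EuclideanSpace ℝ (Fin N) → ℝ}
    (h : MemSolutionClass s u) : Continuous u := by
  obtain ⟨⟨σ, -, hu, -⟩, -⟩ := h
  exact hu.continuous

theorem MemSolutionClass.integrableOn_increment {s : ℝ} (hs0 : 0 < s)
    {u : EuclideanSpace ℝ (Fin N) → ℝ} (h : MemSolutionClass s u)
    (x : EuclideanSpace ℝ (Fin N)) {ε : ℝ} (hε : 0 < ε) :
    IntegrableOn (fun y => (u x - u y) / ‖x - y‖ ^ ((N : ℝ) + 2 * s)) (Metric.ball x ε)ᶜ :=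
  ((memWeightedL1_const hs0 (u x)).sub h.2).integrableOn_compl_ball hs0
    (h.continuous.measurable.const_sub _) x hε

theorem HasFracLaplacianAt.tendsto_integral {s : ℝ} (hs0 : 0 < s) (hs1 : s < 1)
    {u : EuclideanSpace ℝ (Fin N) → ℝ} {L : ℝ} {x : EuclideanSpace ℝ (Fin N)}
    (h : HasFracLaplacianAt s u L x) :
    Tendsto (fun ε : ℝ => ∫ y in (Metric.ball x ε)ᶜ,
      (u x - u y) / ‖x - y‖ ^ ((N : ℝ) + 2 * s)) (𝓝[>] 0) (𝓝 ((normConst N s)⁻¹ * L)) := by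
  refine (Tendsto.const_mul (normConst N s)⁻¹ h).congr fun ε => ?_
  rw [inv_mul_cancel_left₀ (normConst_pos hs0 hs1).ne']

/-- The elementary absorption step: the contact inequality, multiplied out, bounds `m` by a
quantity which does not involve the contact point. -/
theorem rpow_le_of_contact {b κ a s C M t R T m : ℝ} {n : ℕ} (hκ : 1 < κ)
    (ha : 2 * s ≤ a) (hn : a ≤ n * (κ - 1)) (hb : 0 < b) (hC : 0 < C) (hm : 0 < m)
    (ht0 : 0 < t) (ht1 : t ≤ 1) (hR : 0 < R) (hT : 0 ≤ T) (hmM : m ≤ M * t ^ n)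
    (h : b * M ^ κ ≤ C * (M * (R * t) ^ (-(2 * s)) + t ^ (-a) * T)) :
    b * m ^ (κ - 1) ≤ C * (R ^ (-(2 * s)) + T / m) := by
  have htn : t ^ n ≤ 1 := pow_le_one₀ ht0.le ht1
  have htn0 : 0 < t ^ n := pow_pos ht0 n
  have hM0 : 0 < M := by
    by_contra hcon
    nlinarith [mul_nonneg (neg_nonneg.2 (not_lt.1 hcon)) htn0.le]
  have hmM' : m ≤ M := by nlinarith
  have hta : 0 < t ^ (-a) := Real.rpow_pos_of_pos ht0 _
  -- The large power `n` pays for `t ^ (-a)`: from `m ≤ M t^n` and `a ≤ n (κ - 1)`.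
  have h1 : m ^ (κ - 1) * t ^ (-a) ≤ M ^ (κ - 1) := by
    have h2 : m ^ (κ - 1) ≤ M ^ (κ - 1) * t ^ ((n : ℝ) * (κ - 1)) := by
      have := Real.rpow_le_rpow hm.le hmM (by linarith : 0 ≤ κ - 1)
      rwa [Real.mul_rpow hM0.le htn0.le, ← Real.rpow_natCast, ← Real.rpow_mul ht0.le] at this
    have h3 : t ^ ((n : ℝ) * (κ - 1)) ≤ t ^ a := Real.rpow_le_rpow_of_exponent_ge ht0 ht1 hn
    have h4 : m ^ (κ - 1) ≤ M ^ (κ - 1) * t ^ a :=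
      h2.trans (mul_le_mul_of_nonneg_left h3 (Real.rpow_nonneg hM0.le _))
    rwa [Real.rpow_neg ht0.le, ← div_eq_mul_inv, div_le_iff₀ (Real.rpow_pos_of_pos ht0 _)]
  have h5 : (R * t) ^ (-(2 * s)) ≤ R ^ (-(2 * s)) * t ^ (-a) := by
    rw [Real.mul_rpow hR.le ht0.le]
    exact mul_le_mul_of_nonneg_left (Real.rpow_le_rpow_of_exponent_ge ht0 ht1 (by linarith))
      (Real.rpow_nonneg hR.le _)
  have h6 : M ^ κ = M * M ^ (κ - 1) := by
    rw [mul_comm, ← Real.rpow_add_one hM0.ne', sub_add_cancel]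
  have h7 : T ≤ M * (T / m) := by
    rw [← mul_div_assoc, le_div_iff₀ hm, mul_comm]
    exact mul_le_mul_of_nonneg_right hmM' hT
  have h8 : b * (M * (m ^ (κ - 1) * t ^ (-a))) ≤
      C * (M * (R ^ (-(2 * s)) * t ^ (-a)) + t ^ (-a) * (M * (T / m))) :=
    calc b * (M * (m ^ (κ - 1) * t ^ (-a))) ≤ b * M ^ κ := by rw [h6]; gcongr
      _ ≤ C * (M * (R * t) ^ (-(2 * s)) + t ^ (-a) * T) := h
      _ ≤ _ := by gcongr
  refine le_of_mul_le_mul_right (h8.trans_eq' ?_ |>.trans (le_of_eq ?_)) (mul_pos hM0 hta)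
  · ring
  · ring

/-- The comparison `b v ≤ u^τ` behind Souplet's inequality. -/
theorem IsPositiveSolution.mul_le_rpow (hN : 1 ≤ N) {s p q τ b : ℝ} (hs0 : 0 < s) (hs1 : s < 1)
    (hp : 1 < p) (hτ1 : τ ≤ 1) (hτp : 1 < τ * p) (hq : q = τ * (p + 1) - 1) (hb : 0 < b)
    (hbτ : b ^ (p + 1) = τ) {u v : EuclideanSpace ℝ (Fin N) → ℝ}
    (h : IsPositiveSolution s p q u v) (z : EuclideanSpace ℝ (Fin N)) :
    b * v z ≤ u z ^ τ := by
  by_contra! hcon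
  have hτ0 : 0 < τ := hbτ ▸ Real.rpow_pos_of_pos hb _
  have hcu := h.mem_left.continuous
  have hcv := h.mem_right.continuous
  set W : EuclideanSpace ℝ (Fin N) → ℝ := fun y => b * v y - u y ^ τ with hW
  have hWc : Continuous W :=
    (hcv.const_mul b).sub (hcu.rpow_const fun y => Or.inl (h.pos_left y).ne')
  set m := W z with hm
  have hm0 : 0 < m := sub_pos.2 hcon
  set κ := p + 1 - 1 / τ with hκdef
  have hκ : 1 < κ := by
    have : 1 / τ < p := by rw [div_lt_iff₀ hτ0]; linarith
    linarith
  obtain ⟨n, hn⟩ := exists_nat_ge (((N : ℝ) + 2 * s) / (κ - 1))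
  rw [div_le_iff₀ (by linarith)] at hn
  -- A nonzero power makes the bump vanish on the sphere, so the contact point is interior (`0 <
  -- t`).
  have hn0 : n ≠ 0 := by
    rintro rfl
    have : (0 : ℝ) ≤ N := N.cast_nonneg
    simp only [Nat.cast_zero, zero_mul] at hn
    linarith
  obtain ⟨C, hC, hcontact⟩ := exists_contact_estimate hN hs0 hs1 n
  have hc := normConst_pos (N := N) hs0 hs1
  have hV : MemWeightedL1 s (fun y => b * v y) := h.mem_right.2.const_mul b
  have hVm : Measurable (fun y => b * v y) := (hcv.const_mul b).measurable
  have hV0 : ∀ y, 0 ≤ b * v y := fun y => (mul_pos hb (h.pos_right y)).le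
  have hest : ∀ R : ℝ, 1 ≤ R → b * m ^ (κ - 1) ≤ normConst N s * C *
      (R ^ (-(2 * s)) + (∫ y, b * v y / (R + ‖y - z‖) ^ ((N : ℝ) + 2 * s)) / m) := by
    intro R hR
    have hR0 : 0 < R := by linarith
    obtain ⟨x, hxmem, hxmax⟩ := (isCompact_closedBall z R).exists_isMaxOn
      ⟨z, Metric.mem_closedBall_self hR0.le⟩
      (f := fun y => W y * (1 - ‖y - z‖ ^ 2 / R ^ 2) ^ n) (by fun_prop)
    have hmax : ∀ y ∈ Metric.closedBall z R, W y * (1 - ‖y - z‖ ^ 2 / R ^ 2) ^ n ≤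
      W x * (1 - ‖x - z‖ ^ 2 / R ^ 2) ^ n := fun y hy => hxmax hy
    obtain ⟨t, ht⟩ : ∃ t, t = 1 - ‖x - z‖ ^ 2 / R ^ 2 := ⟨_, rfl⟩
    rw [← ht] at hmax
    have hmM : m ≤ W x * t ^ n := by
      have := hmax z (Metric.mem_closedBall_self hR0.le)
      simpa using this
    have htnonneg : 0 ≤ t := by
      rw [Metric.mem_closedBall, dist_eq_norm] at hxmem
      rw [ht, sub_nonneg, div_le_one (by positivity)]
      gcongr
    have ht0 : 0 < t := by
      refine htnonneg.lt_of_ne fun h0 => ?_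
      rw [← h0, zero_pow hn0, mul_zero] at hmM
      linarith
    have ht1 : t ≤ 1 := by
      have : 0 ≤ ‖x - z‖ ^ 2 / R ^ 2 := by positivity
      linarith
    have hWx : 0 < W x := by
      have : 0 < t ^ n := pow_pos ht0 n
      by_contra hneg
      nlinarith [mul_nonneg (neg_nonneg.2 (not_lt.1 hneg)) this.le]
    -- Slope at `u x` of the tangent to `r ↦ r^τ`.
    set A := τ * u x ^ (τ - 1) with hA
    have hsplit : ∀ y, (b * (v x - v y) - A * (u x - u y)) / ‖x - y‖ ^ ((N : ℝ) + 2 * s) =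
        b * ((v x - v y) / ‖x - y‖ ^ ((N : ℝ) + 2 * s)) -
          A * ((u x - u y) / ‖x - y‖ ^ ((N : ℝ) + 2 * s)) := fun y => by ring
    have hiu := fun (ε : ℝ) (hε : 0 < ε) =>
      (h.mem_left.integrableOn_increment hs0 x hε).const_mul A
    have hiv := fun (ε : ℝ) (hε : 0 < ε) =>
      (h.mem_right.integrableOn_increment hs0 x hε).const_mul b
    have hWG : ∀ y, W x - W y ≤ b * (v x - v y) - A * (u x - u y) := fun y => by
      have := rpow_le_add_mul_sub hτ0.le hτ1 (h.pos_left x) (h.pos_left y)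
      simp only [hW]
      linarith
    have hlim := ((h.eq_right x).tendsto_integral hs0 hs1).const_mul b |>.sub
      (((h.eq_left x).tendsto_integral hs0 hs1).const_mul A)
    have hL := hcontact x z R t W (fun y => b * (v x - v y) - A * (u x - u y))
      (fun y => b * v y) _ hR ht0 ht
      (fun ε hε => by
        simp only [hsplit]
        exact (hiv ε hε).sub (hiu ε hε)) hV hVm hV0
      (hlim.congr' (by
        filter_upwards [self_mem_nhdsWithin] with ε hε
        simp only [hsplit]
        rw [integral_sub (hiv ε hε) (hiu ε hε), integral_const_mul, integral_const_mul]))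
      hWG
      (fun y => by
        have h1 := hWG y
        have h2 : W y ≤ b * v y := sub_le_self _ (Real.rpow_nonneg (h.pos_left y).le _)
        linarith)
      hWx hmax
    have hreact := reaction_le_neg_rpow hp hτ1 hτp hb hbτ (h.pos_left x) (h.pos_right x) hWx
    rw [← hq] at hreact
    refine rpow_le_of_contact hκ (by linarith [N.cast_nonneg (α := ℝ)]) hn hb
      (mul_pos hc hC) hm0 ht0 ht1 hR0
      (integral_nonneg fun y => ?_) hmM ?_
    · have := hV0 y
      simp only [Pi.zero_apply]
      positivity
    · have e : b * ((normConst N s)⁻¹ * u x ^ q) - A * ((normConst N s)⁻¹ * v x ^ p) =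
        (normConst N s)⁻¹ * (b * u x ^ q - τ * u x ^ (τ - 1) * v x ^ p) := by ring
      rw [e, ← div_eq_inv_mul, le_div_iff₀ hc] at hL
      linarith
  -- `m` does not depend on `R`, so `R → ∞` gives `b m^(κ-1) ≤ 0`.
  have hlim : Tendsto (fun R : ℝ => normConst N s * C *
      (R ^ (-(2 * s)) + (∫ y, b * v y / (R + ‖y - z‖) ^ ((N : ℝ) + 2 * s)) / m)) atTop
      (𝓝 (normConst N s * C * (0 + 0 / m))) :=
    ((tendsto_rpow_neg_atTop (by positivity)).add
      ((hV.tendsto_integral_div_add_norm_sub hs0 hVm z).div_const m)).const_mul _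
  have hle := ge_of_tendsto hlim (eventually_atTop.2 ⟨1, hest⟩)
  rw [zero_div, add_zero, mul_zero] at hle
  have : 0 < b * m ^ (κ - 1) := by positivity
  linarith

end Comparison

end FracLaneEmden

theorem proposition3p3 (N : ℕ) (hN : 1 ≤ N) (s : ℝ) (hs0 : 0 < s) (hs1 : s < 1)
    (p q : ℝ) (hq : 1 < q) (hpq : q ≤ p) (u v : EuclideanSpace ℝ (Fin N) → ℝ)
    (huv : FracLaneEmden.IsPositiveSolution s p q u v) (x : EuclideanSpace ℝ (Fin N)) :
    v x ^ (p + 1) / (p + 1) ≤ u x ^ (q + 1) / (q + 1) := by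
  have hp1 : 0 < p + 1 := by linarith
  have hq1 : 0 < q + 1 := by linarith
  obtain ⟨τ, hτ⟩ : ∃ τ, τ = (q + 1) / (p + 1) := ⟨_, rfl⟩
  have hτ0 : 0 < τ := hτ ▸ div_pos hq1 hp1
  have hτp : τ * (p + 1) = q + 1 := by rw [hτ]; field_simp
  have hτ1 : τ ≤ 1 := by rw [hτ, div_le_one hp1]; linarith
  have hb : 0 < τ ^ (p + 1)⁻¹ := Real.rpow_pos_of_pos hτ0 _
  have hbτ : (τ ^ (p + 1)⁻¹) ^ (p + 1) = τ := Real.rpow_inv_rpow hτ0.le hp1.ne'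
  -- Here `τ p = q + 1 - τ ≥ q > 1`.
  have hmain := huv.mul_le_rpow hN hs0 hs1 (by linarith) hτ1 (by linarith) (by linarith) hb hbτ x
  have hpow := Real.rpow_le_rpow (mul_pos hb (huv.pos_right x)).le hmain hp1.le
  rw [Real.mul_rpow hb.le (huv.pos_right x).le, hbτ, ← Real.rpow_mul (huv.pos_left x).le, hτp,
    hτ, div_mul_eq_mul_div, div_le_iff₀ hp1] at hpow
  rw [div_le_div_iff₀ hp1 hq1]
  linarith
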